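/- Lemma 3.1. Let $n<\omega$ and let $\kappa$ be an ordinal. Conventions. A $\Pi^1_n$-formula is a formula of second-order logic over the symbols $\in$ and one unary predicate, consisting of $n$ alternating blocks of second-order quantifiers (ranging over subsets of the domain), the first block universal, followed by a formula without second-order quantifiers. If $\alpha$ is a regular cardinal, a set $S\subseteq\alpha$ is called *$\Pi^1_n$-indescribable (in $\alpha$)* if for every $A\subseteq V_\alpha$ and every $\Pi^1_n$-sentence $\varphi$ with $(V_\alpha,\in,A)\models\varphi$ there is $\beta\in S$ with $(V_\beta,\in,A\cap V_\beta)\models\varphi$. If $\alpha$ is not a regular cardinal, no subset of $\alpha$ is $\Pi^1_n$-indescribable in $\alpha$. We say that $\mathrm{Refl}_n(\kappa)$ holds if $\kappa$ is a $\Pi^1_n$-indescribable cardinal (that is, $\kappa$ is a $\Pi^1_n$-indescribable subset of itself) and for every $\Pi^1_n$-indescribable set $S\subseteq\kappa$ there is $\gamma<\kappa$ such that $S\cap\gamma$ is $\Pi^1_n$-indescribable in $\gamma$. Claim. Suppose $\mathrm{Refl}_n(\kappa)$ holds and $S$ is a $\Pi^1_n$-indescribable subset of $\kappa$. Then $$\mathrm{Tr}_n(S)=\{\alpha<\kappa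 : S\cap\alpha \text{ is } \Pi^1_n\text{-indescribable in } \alpha\}$$ is a $\Pi^1_n$-indescribable subset of $\kappa$. -/

import Mathlib

universe u

/-- Formulas of second-order set theory with equality, in de Bruijn style: `SOFormula m k` is the
type of formulas with `m` free element variables and `k` free set variables.  In both contexts a
quantifier binds the variable with index `0` and shifts the others. -/
inductive SOFormula : ℕ → ℕ → Type
  | /-- `xᵢ = xⱼ` -/ eq {m k : ℕ} (i j : Fin m) : SOFormula m k
  | /-- `xᵢ ∈ xⱼ` -/ mem {m k : ℕ} (i j : Fin m) : SOFormula m k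
  | /-- `xᵢ ∈ Xⱼ` -/ pred {m k : ℕ} (i : Fin m) (j : Fin k) : SOFormula m k
  | neg {m k : ℕ} (φ : SOFormula m k) : SOFormula m k
  | and {m k : ℕ} (φ ψ : SOFormula m k) : SOFormula m k
  | /-- `∀ x, φ` -/ all {m k : ℕ} (φ : SOFormula (m + 1) k) : SOFormula m k
  | /-- `∀ X, φ` -/ allSet {m k : ℕ} (φ : SOFormula m (k + 1)) : SOFormula m k
  | /-- `∃ X, φ` -/ exSet {m k : ℕ} (φ : SOFormula m (k + 1)) : SOFormula m k

namespace SOFormula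

/-- Satisfaction in a structure `(M, E)` under full second-order semantics: set variables range
over all subsets of `M`. -/
def Realize {M : Type*} (E : M → M → Prop) :
    {m k : ℕ} → SOFormula m k → (Fin m → M) → (Fin k → Set M) → Prop
  | _, _, eq i j, v, _ => v i = v j
  | _, _, mem i j, v, _ => E (v i) (v j)
  | _, _, pred i j, v, X => v i ∈ X j
  | _, _, neg φ, v, X => ¬ φ.Realize E v X
  | _, _, and φ ψ, v, X => φ.Realize E v X ∧ ψ.Realize E v X
  | _, _, all φ, v, X => ∀ a : M, φ.Realize E (Fin.cons a v) X
  | _, _, allSet φ, v, X => ∀ Y : Set M, φ.Realize E v (Fin.cons Y X)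
  | _, _, exSet φ, v, X => ∃ Y : Set M, φ.Realize E v (Fin.cons Y X)

/-- The formula has no set quantifiers (free set variables are allowed). -/
def IsFirstOrder : {m k : ℕ} → SOFormula m k → Prop
  | _, _, eq _ _ => True
  | _, _, mem _ _ => True
  | _, _, pred _ _ => True
  | _, _, neg φ => φ.IsFirstOrder
  | _, _, and φ ψ => φ.IsFirstOrder ∧ ψ.IsFirstOrder
  | _, _, all φ => φ.IsFirstOrder
  | _, _, allSet _ => False
  | _, _, exSet _ => False

mutual

/-- `IsPi n φ`: `φ` is a `Π¹ₙ` formula, that is, a prefix of `n` alternating (possibly empty) blocks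
of set quantifiers, the first of them universal, followed by a first-order formula. -/
inductive IsPi : ℕ → {m k : ℕ} → SOFormula m k → Prop
  | firstOrder {m k : ℕ} {φ : SOFormula m k} (h : φ.IsFirstOrder) : IsPi 0 φ
  | ofSigma {n m k : ℕ} {φ : SOFormula m k} (h : IsSigma n φ) : IsPi (n + 1) φ
  | allSet {n m k : ℕ} {φ : SOFormula m (k + 1)} (h : IsPi (n + 1) φ) : IsPi (n + 1) φ.allSet

/-- `IsSigma n φ`: `φ` is a `Σ¹ₙ` formula; as `IsPi`, with the first block existential. -/
inductive IsSigma : ℕ → {m k : ℕ} → SOFormula m k → Prop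
  | firstOrder {m k : ℕ} {φ : SOFormula m k} (h : φ.IsFirstOrder) : IsSigma 0 φ
  | ofPi {n m k : ℕ} {φ : SOFormula m k} (h : IsPi n φ) : IsSigma (n + 1) φ
  | exSet {n m k : ℕ} {φ : SOFormula m (k + 1)} (h : IsSigma (n + 1) φ) :
      IsSigma (n + 1) φ.exSet

end

end SOFormula

/-- `(V_α, ∈, A ∩ V_α) ⊨ φ`, where the predicate for `A` is the only free variable of `φ`. -/
def RankSatisfies (α : Ordinal.{u}) (A : ZFSet.{u}) (φ : SOFormula 0 1) : Prop :=
  φ.Realize (M := {x : ZFSet.{u} // x ∈ ZFSet.vonNeumann α}) (fun x y => x.1 ∈ y.1)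
    Fin.elim0 (fun _ => {x | x.1 ∈ A ∩ ZFSet.vonNeumann α})

/-- The ordinal `κ` is (the initial ordinal of) an infinite regular cardinal. -/
def IsRegularOrdinal (κ : Ordinal.{u}) : Prop :=
  ∃ c : Cardinal.{u}, c.IsRegular ∧ c.ord = κ

/-- `S` is a `Π¹ₙ`-indescribable subset of the regular cardinal `κ`, that is, `S ∈ Π¹ₙ(κ)⁺`. -/
def IsIndescribable (n : ℕ) (κ : Ordinal.{u}) (S : Set Ordinal.{u}) : Prop :=
  IsRegularOrdinal κ ∧ S ⊆ Set.Iio κ ∧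
    ∀ A : ZFSet.{u}, A ⊆ ZFSet.vonNeumann κ → ∀ φ : SOFormula 0 1, φ.IsPi n →
      RankSatisfies κ A φ → ∃ α ∈ S, RankSatisfies α A φ

/-- The `Π¹ₙ`-reflection principle `Reflₙ(κ)`.  The ordinal `κ` is identified with the set
`Set.Iio κ` of smaller ordinals. -/
def Refl (n : ℕ) (κ : Ordinal.{u}) : Prop :=
  IsIndescribable n κ (Set.Iio κ) ∧
    ∀ S : Set Ordinal.{u}, IsIndescribable n κ S → ∃ γ < κ, IsIndescribable n γ (S ∩ Set.Iio γ)

/-- The trace operation `Trₙ(S) = {α < κ | S ∩ α is Π¹ₙ-indescribable in α}` on subsets of `κ`. -/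
def Tr (n : ℕ) (κ : Ordinal.{u}) (S : Set Ordinal.{u}) : Set Ordinal.{u} :=
  {α | α < κ ∧ IsIndescribable n α (S ∩ Set.Iio α)}

universe v

namespace SOFormula

/-- Implication. -/
def imp {m k : ℕ} (φ ψ : SOFormula m k) : SOFormula m k := neg (and φ (neg ψ))

/-- Biconditional. -/
def iff {m k : ℕ} (φ ψ : SOFormula m k) : SOFormula m k := and (imp φ ψ) (imp ψ φ)

/-- Existential quantification over elements. -/
def ex {m k : ℕ} (φ : SOFormula (m + 1) k) : SOFormula m k := neg (all (neg φ))

section Realize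

variable {M : Type*} {E : M → M → Prop} {m k : ℕ} {v : Fin m → M} {X : Fin k → Set M}

@[simp] theorem realize_eq (i j : Fin m) : (eq i j).Realize E v X ↔ v i = v j := Iff.rfl

@[simp] theorem realize_mem (i j : Fin m) : (mem i j).Realize E v X ↔ E (v i) (v j) := Iff.rfl

@[simp] theorem realize_pred (i : Fin m) (j : Fin k) :
    (pred i j).Realize E v X ↔ v i ∈ X j := Iff.rfl

@[simp] theorem realize_neg (φ : SOFormula m k) :
    φ.neg.Realize E v X ↔ ¬ φ.Realize E v X := Iff.rfl

@[simp] theorem realize_and (φ ψ : SOFormula m k) :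
    (φ.and ψ).Realize E v X ↔ φ.Realize E v X ∧ ψ.Realize E v X := Iff.rfl

@[simp] theorem realize_all (φ : SOFormula (m + 1) k) :
    φ.all.Realize E v X ↔ ∀ a : M, φ.Realize E (Fin.cons a v) X := Iff.rfl

@[simp] theorem realize_allSet (φ : SOFormula m (k + 1)) :
    φ.allSet.Realize E v X ↔ ∀ Y : Set M, φ.Realize E v (Fin.cons Y X) := Iff.rfl

@[simp] theorem realize_exSet (φ : SOFormula m (k + 1)) :
    φ.exSet.Realize E v X ↔ ∃ Y : Set M, φ.Realize E v (Fin.cons Y X) := Iff.rfl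

@[simp] theorem realize_imp (φ ψ : SOFormula m k) :
    (φ.imp ψ).Realize E v X ↔ (φ.Realize E v X → ψ.Realize E v X) := by
  simp [imp]

@[simp] theorem realize_iff (φ ψ : SOFormula m k) :
    (φ.iff ψ).Realize E v X ↔ (φ.Realize E v X ↔ ψ.Realize E v X) := by
  simp [iff, iff_iff_implies_and_implies]

@[simp] theorem realize_ex (φ : SOFormula (m + 1) k) :
    φ.ex.Realize E v X ↔ ∃ a : M, φ.Realize E (Fin.cons a v) X := by
  simp [ex]

end Realize

/-! ### Coding several set variables by one -/

/-- `xⱼ = {xᵢ}` for `b = false`, and `xⱼ = 𝒫 xᵢ` for `b = true`. -/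
def isOp {m k : ℕ} : Bool → Fin m → Fin m → SOFormula m k
  | false, i, j => all (iff (mem 0 j.succ) (eq 0 i.succ))
  | true, i, j => all (iff (mem 0 j.succ) (all (imp (mem 0 1) (mem 0 i.succ.succ))))

/-- The relation on a structure that is defined by `isOp`. -/
def IsOp {M : Type*} (E : M → M → Prop) : Bool → M → M → Prop
  | false, x, y => ∀ z, E z y ↔ z = x
  | true, x, y => ∀ z, E z y ↔ ∀ w, E w z → E w x

/-- The result of applying to `xᵢ` the operations listed in `w`, the head of the list first, is a
member of `Xⱼ`. -/
def decode {k : ℕ} : List Bool → {m : ℕ} → Fin m → Fin k → SOFormula m k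
  | [], _, i, j => pred i j
  | b :: w, _, i, j => ex (and (isOp b i.succ 0) (decode w 0 j))

/-- The relation on a structure that is defined by `decode`. -/
def Decode {M : Type*} (E : M → M → Prop) : List Bool → M → Set M → Prop
  | [], x, Y => x ∈ Y
  | b :: w, x, Y => ∃ y, IsOp E b x y ∧ Decode E w y Y

theorem realize_isOp {M : Type*} {E : M → M → Prop} {m k : ℕ} (b : Bool) (i j : Fin m)
    (v : Fin m → M) (X : Fin k → Set M) :
    (isOp b i j).Realize E v X ↔ IsOp E b (v i) (v j) := by
  cases b
  · simp [isOp, IsOp]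
  · simp only [isOp, IsOp, realize_all, realize_iff, realize_imp, realize_mem, Fin.cons_succ]
    rfl

theorem realize_decode {M : Type*} {E : M → M → Prop} {k : ℕ} (w : List Bool) {m : ℕ} (i : Fin m)
    (j : Fin k) (v : Fin m → M) (X : Fin k → Set M) :
    (decode w i j).Realize E v X ↔ Decode E w (v i) (X j) := by
  induction w generalizing m with
  | nil => simp [decode, Decode]
  | cons b w ih => simp [decode, Decode, ih, realize_isOp]

theorem isFirstOrder_isOp {m k : ℕ} (b : Bool) (i j : Fin m) :
    (isOp b i j : SOFormula m k).IsFirstOrder := by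
  cases b <;> simp [isOp, iff, imp, IsFirstOrder]

theorem isFirstOrder_decode {k : ℕ} (w : List Bool) {m : ℕ} (i : Fin m) (j : Fin k) :
    (decode w i j).IsFirstOrder := by
  induction w generalizing m with
  | nil => trivial
  | cons b w ih => exact ⟨isFirstOrder_isOp _ _ _, ih _⟩

/-- Extend an interpretation of set variables by codes to one more, bound, set variable. -/
def liftCode {k k' : ℕ} (σ : Fin k → List Bool × Fin k') : Fin (k + 1) → List Bool × Fin (k' + 1) :=
  Fin.cons ([], 0) fun j => ((σ j).1, (σ j).2.succ)

/-- Replace the atomic formulas `xᵢ ∈ Xⱼ` by `decode` formulas. -/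
def translate : {m k k' : ℕ} → (Fin k → List Bool × Fin k') → SOFormula m k → SOFormula m k'
  | _, _, _, _, eq i j => eq i j
  | _, _, _, _, mem i j => mem i j
  | _, _, _, σ, pred i j => decode (σ j).1 i (σ j).2
  | _, _, _, σ, neg φ => neg (φ.translate σ)
  | _, _, _, σ, and φ ψ => and (φ.translate σ) (ψ.translate σ)
  | _, _, _, σ, all φ => all (φ.translate σ)
  | _, _, _, σ, allSet φ => allSet (φ.translate (liftCode σ))
  | _, _, _, σ, exSet φ => exSet (φ.translate (liftCode σ))

theorem decode_liftCode {M : Type*} {E : M → M → Prop} {k k' : ℕ} {σ : Fin k → List Bool × Fin k'}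
    {X : Fin k → Set M} {X' : Fin k' → Set M}
    (h : ∀ j x, Decode E (σ j).1 x (X' (σ j).2) ↔ x ∈ X j) (Y : Set M) (j : Fin (k + 1)) (x : M) :
    Decode E (liftCode σ j).1 x ((Fin.cons Y X' : Fin (k' + 1) → Set M) (liftCode σ j).2) ↔
      x ∈ (Fin.cons Y X : Fin (k + 1) → Set M) j := by
  refine Fin.cases ?_ (fun j => ?_) j
  · simp [liftCode, Decode]
  · simpa [liftCode] using h j x

theorem realize_translate {M : Type*} {E : M → M → Prop} {m k k' : ℕ} (φ : SOFormula m k)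
    (σ : Fin k → List Bool × Fin k') (v : Fin m → M) (X : Fin k → Set M) (X' : Fin k' → Set M)
    (h : ∀ j x, Decode E (σ j).1 x (X' (σ j).2) ↔ x ∈ X j) :
    (φ.translate σ).Realize E v X' ↔ φ.Realize E v X := by
  induction φ generalizing k' with
  | eq i j => rfl
  | mem i j => rfl
  | pred i j => simp [translate, realize_decode, h]
  | neg φ ih => simp [translate, ih σ v X X' h]
  | and φ ψ ih₁ ih₂ => simp [translate, ih₁ σ v X X' h, ih₂ σ v X X' h]
  | all φ ih => exact forall_congr' fun a => ih σ _ X X' h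
  | allSet φ ih => exact forall_congr' fun Y => ih _ v _ _ (decode_liftCode h Y)
  | exSet φ ih => exact exists_congr fun Y => ih _ v _ _ (decode_liftCode h Y)

theorem IsFirstOrder.translate {m k k' : ℕ} {φ : SOFormula m k} (h : φ.IsFirstOrder)
    (σ : Fin k → List Bool × Fin k') : (φ.translate σ).IsFirstOrder := by
  induction φ generalizing k' with
  | eq i j => trivial
  | mem i j => trivial
  | pred i j => exact isFirstOrder_decode _ _ _
  | neg φ ih => exact ih h σ
  | and φ ψ ih₁ ih₂ => exact ⟨ih₁ h.1 σ, ih₂ h.2 σ⟩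
  | all φ ih => exact ih h σ
  | allSet φ ih => exact h.elim
  | exSet φ ih => exact h.elim

/-! ### The hierarchy of formulas -/

mutual

theorem IsPi.translate : {n m k k' : ℕ} → {φ : SOFormula m k} → φ.IsPi n →
    (σ : Fin k → List Bool × Fin k') → (φ.translate σ).IsPi n
  | _, _, _, _, _, .firstOrder h, σ => .firstOrder (h.translate σ)
  | _, _, _, _, _, .ofSigma h, σ => .ofSigma (h.translate σ)
  | _, _, _, _, _, .allSet h, σ => .allSet (h.translate (liftCode σ))

theorem IsSigma.translate : {n m k k' : ℕ} → {φ : SOFormula m k} → φ.IsSigma n →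
    (σ : Fin k → List Bool × Fin k') → (φ.translate σ).IsSigma n
  | _, _, _, _, _, .firstOrder h, σ => .firstOrder (h.translate σ)
  | _, _, _, _, _, .ofPi h, σ => .ofPi (h.translate σ)
  | _, _, _, _, _, .exSet h, σ => .exSet (h.translate (liftCode σ))

end

mutual

theorem IsPi.succ : {n m k : ℕ} → {φ : SOFormula m k} → φ.IsPi n → φ.IsPi (n + 1)
  | _, _, _, _, .firstOrder h => .ofSigma (.firstOrder h)
  | _, _, _, _, .ofSigma h => .ofSigma h.succ
  | _, _, _, _, .allSet h => .allSet h.succ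

theorem IsSigma.succ : {n m k : ℕ} → {φ : SOFormula m k} → φ.IsSigma n → φ.IsSigma (n + 1)
  | _, _, _, _, .firstOrder h => .ofPi (.firstOrder h)
  | _, _, _, _, .ofPi h => .ofPi h.succ
  | _, _, _, _, .exSet h => .exSet h.succ

end

theorem IsFirstOrder.isPi {m k : ℕ} {φ : SOFormula m k} (h : φ.IsFirstOrder) (n : ℕ) :
    φ.IsPi n := by
  induction n with
  | zero => exact .firstOrder h
  | succ n ih => exact ih.succ

/-- Two formulas are equivalent in all structures whose domain lies in the universe `v`. -/
def Equivalent {m k : ℕ} (φ ψ : SOFormula m k) : Prop :=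
  ∀ (M : Type v) (E : M → M → Prop) (a : Fin m → M) (X : Fin k → Set M),
    φ.Realize E a X ↔ ψ.Realize E a X

mutual

theorem IsPi.exists_neg : {n m k : ℕ} → {φ : SOFormula m k} → φ.IsPi n →
    ∃ ψ : SOFormula m k, ψ.IsSigma n ∧ Equivalent.{v} ψ φ.neg
  | _, _, _, φ, .firstOrder h => ⟨φ.neg, .firstOrder h, fun _ _ _ _ => Iff.rfl⟩
  | _, _, _, _, .ofSigma h =>
    let ⟨ψ, hψ, e⟩ := h.exists_neg
    ⟨ψ, .ofPi hψ, e⟩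
  | _, _, _, _, .allSet h =>
    let ⟨ψ, hψ, e⟩ := h.exists_neg
    ⟨ψ.exSet, .exSet hψ, fun M E a X =>
      (exists_congr fun Y => e M E a (Fin.cons Y X)).trans not_forall.symm⟩

theorem IsSigma.exists_neg : {n m k : ℕ} → {φ : SOFormula m k} → φ.IsSigma n →
    ∃ ψ : SOFormula m k, ψ.IsPi n ∧ Equivalent.{v} ψ φ.neg
  | _, _, _, φ, .firstOrder h => ⟨φ.neg, .firstOrder h, fun _ _ _ _ => Iff.rfl⟩
  | _, _, _, _, .ofPi h =>
    let ⟨ψ, hψ, e⟩ := h.exists_neg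
    ⟨ψ, .ofSigma hψ, e⟩
  | _, _, _, _, .exSet h =>
    let ⟨ψ, hψ, e⟩ := h.exists_neg
    ⟨ψ.allSet, .allSet hψ, fun M E a X =>
      (forall_congr' fun Y => e M E a (Fin.cons Y X)).trans not_exists.symm⟩

end

/-- The codes that add a dummy set variable with index `0`. -/
def weakenCode (k : ℕ) : Fin k → List Bool × Fin (k + 1) := fun j => ([], j.succ)

theorem realize_weaken {M : Type*} {E : M → M → Prop} {m k : ℕ} (φ : SOFormula m k)
    (v : Fin m → M) (X : Fin k → Set M) (Y : Set M) :
    (φ.translate (weakenCode k)).Realize E v (Fin.cons Y X) ↔ φ.Realize E v X :=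
  realize_translate φ _ v X _ fun j x => by simp [weakenCode, Decode]

/-- Closure of a class of formulas under conjunction, up to equivalence. -/
def ClosedUnderAnd (P : ∀ {m k : ℕ}, SOFormula m k → Prop) : Prop :=
  ∀ {m k : ℕ} {φ ψ : SOFormula m k}, P φ → P ψ →
    ∃ χ : SOFormula m k, P χ ∧ Equivalent.{v} χ (φ.and ψ)

theorem IsPi.exists_and_of_isSigma {n : ℕ} (H : ClosedUnderAnd.{v} (IsSigma n)) :
    {m k : ℕ} → {φ ψ : SOFormula m k} → φ.IsSigma n → ψ.IsPi (n + 1) →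
      ∃ χ : SOFormula m k, χ.IsPi (n + 1) ∧ Equivalent.{v} χ (φ.and ψ)
  | _, _, _, _, hφ, .ofSigma hψ =>
    let ⟨χ, hχ, e⟩ := H hφ hψ
    ⟨χ, .ofSigma hχ, e⟩
  | _, k, _, _, hφ, .allSet hψ =>
    let ⟨χ, hχ, e⟩ := exists_and_of_isSigma H (hφ.translate (weakenCode k)) hψ
    ⟨χ.allSet, .allSet hχ, fun M E a X => by
      simp [e M E a _, realize_weaken, forall_and]⟩

theorem IsPi.exists_and_of_closedUnderAnd {n : ℕ} (H : ClosedUnderAnd.{v} (IsSigma n)) :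
    {m k : ℕ} → {φ ψ : SOFormula m k} → φ.IsPi (n + 1) → ψ.IsPi (n + 1) →
      ∃ χ : SOFormula m k, χ.IsPi (n + 1) ∧ Equivalent.{v} χ (φ.and ψ)
  | _, _, _, _, .ofSigma hφ, hψ => exists_and_of_isSigma H hφ hψ
  | _, k, _, _, .allSet hφ, hψ =>
    let ⟨χ, hχ, e⟩ := exists_and_of_closedUnderAnd H hφ (hψ.translate (weakenCode k))
    ⟨χ.allSet, .allSet hχ, fun M E a X => by
      simp [e M E a _, realize_weaken, forall_and]⟩

theorem IsSigma.exists_and_of_isPi {n : ℕ} (H : ClosedUnderAnd.{v} (IsPi n)) :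
    {m k : ℕ} → {φ ψ : SOFormula m k} → φ.IsPi n → ψ.IsSigma (n + 1) →
      ∃ χ : SOFormula m k, χ.IsSigma (n + 1) ∧ Equivalent.{v} χ (φ.and ψ)
  | _, _, _, _, hφ, .ofPi hψ =>
    let ⟨χ, hχ, e⟩ := H hφ hψ
    ⟨χ, .ofPi hχ, e⟩
  | _, k, _, _, hφ, .exSet hψ =>
    let ⟨χ, hχ, e⟩ := exists_and_of_isPi H (hφ.translate (weakenCode k)) hψ
    ⟨χ.exSet, .exSet hχ, fun M E a X => by
      simp [e M E a _, realize_weaken]⟩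

theorem IsSigma.exists_and_of_closedUnderAnd {n : ℕ} (H : ClosedUnderAnd.{v} (IsPi n)) :
    {m k : ℕ} → {φ ψ : SOFormula m k} → φ.IsSigma (n + 1) → ψ.IsSigma (n + 1) →
      ∃ χ : SOFormula m k, χ.IsSigma (n + 1) ∧ Equivalent.{v} χ (φ.and ψ)
  | _, _, _, _, .ofPi hφ, hψ => exists_and_of_isPi H hφ hψ
  | _, k, _, _, .exSet hφ, hψ =>
    let ⟨χ, hχ, e⟩ := exists_and_of_closedUnderAnd H hφ (hψ.translate (weakenCode k))
    ⟨χ.exSet, .exSet hχ, fun M E a X => by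
      simp [e M E a _, realize_weaken]⟩

theorem closedUnderAnd (n : ℕ) :
    ClosedUnderAnd.{v} (IsPi n) ∧ ClosedUnderAnd.{v} (IsSigma n) := by
  induction n with
  | zero =>
    constructor
    · rintro m k φ ψ ⟨hφ⟩ ⟨hψ⟩
      exact ⟨φ.and ψ, .firstOrder ⟨hφ, hψ⟩, fun _ _ _ _ => Iff.rfl⟩
    · rintro m k φ ψ ⟨hφ⟩ ⟨hψ⟩
      exact ⟨φ.and ψ, .firstOrder ⟨hφ, hψ⟩, fun _ _ _ _ => Iff.rfl⟩
  | succ n ih =>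
    exact ⟨IsPi.exists_and_of_closedUnderAnd ih.2, IsSigma.exists_and_of_closedUnderAnd ih.1⟩

theorem IsPi.exists_and {n m k : ℕ} {φ ψ : SOFormula m k} (hφ : φ.IsPi n) (hψ : ψ.IsPi n) :
    ∃ χ : SOFormula m k, χ.IsPi n ∧ Equivalent.{v} χ (φ.and ψ) :=
  (closedUnderAnd n).1 hφ hψ

/-- Every element is a member of some element. -/
def limit (k : ℕ) : SOFormula 0 k := all (ex (mem 1 0))

theorem isFirstOrder_limit (k : ℕ) : (limit k).IsFirstOrder := trivial

theorem realize_limit {M : Type*} {E : M → M → Prop} {k : ℕ} (v : Fin 0 → M) (X : Fin k → Set M) :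
    (limit k).Realize E v X ↔ ∀ x, ∃ y, E x y := by
  simp only [limit, realize_all, realize_ex, realize_mem]
  rfl

end SOFormula

open SOFormula

/-- Apply to `x` the operations listed in `w`, the head of the list first; `false` stands for the
singleton and `true` for the power set. -/
def codeWord : List Bool → ZFSet.{u} → ZFSet.{u}
  | [], x => x
  | false :: w, x => codeWord w {x}
  | true :: w, x => codeWord w x.powerset

/-- The word of the operation `x ↦ 𝒫ⁱ {{x}}`. -/
def indexWord (i : ℕ) : List Bool := false :: false :: List.replicate i true

theorem codeWord_replicate (i : ℕ) (x : ZFSet.{u}) :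
    codeWord (List.replicate i true) x = ZFSet.powerset^[i] x := by
  induction i generalizing x with
  | zero => rfl
  | succ i ih => simpa [List.replicate_succ, codeWord] using ih x.powerset

theorem powerset_injective : Function.Injective ZFSet.powerset.{u} := by
  intro x y h
  have hx : x ∈ y.powerset := h ▸ ZFSet.mem_powerset.2 (fun _ hz => hz)
  have hy : y ∈ x.powerset := h ▸ ZFSet.mem_powerset.2 (fun _ hz => hz)
  exact ZFSet.ext fun z => ⟨fun hz => ZFSet.mem_powerset.1 hx hz,
    fun hz => ZFSet.mem_powerset.1 hy hz⟩

theorem powerset_ne_singleton_singleton (x y : ZFSet.{u}) : x.powerset ≠ {{y}} := by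
  intro h
  have h0 : (∅ : ZFSet.{u}) ∈ x.powerset :=
    ZFSet.mem_powerset.2 fun z hz => (ZFSet.notMem_empty z hz).elim
  rw [h, ZFSet.mem_singleton] at h0
  exact ZFSet.notMem_empty y (h0 ▸ ZFSet.mem_singleton.2 rfl)

theorem iterate_powerset_inj {i j : ℕ} {x y : ZFSet.{u}}
    (h : ZFSet.powerset^[i] {{x}} = ZFSet.powerset^[j] {{y}}) : i = j ∧ x = y := by
  induction i generalizing j with
  | zero =>
    cases j with
    | zero => exact ⟨rfl, by simpa using h⟩
    | succ j =>
      rw [Function.iterate_succ_apply'] at h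
      exact (powerset_ne_singleton_singleton _ _ h.symm).elim
  | succ i ih =>
    cases j with
    | zero =>
      rw [Function.iterate_succ_apply'] at h
      exact (powerset_ne_singleton_singleton _ _ h).elim
    | succ j =>
      rw [Function.iterate_succ_apply', Function.iterate_succ_apply'] at h
      obtain ⟨rfl, rfl⟩ := ih (powerset_injective h)
      exact ⟨rfl, rfl⟩

theorem codeWord_indexWord_inj {i j : ℕ} {x y : ZFSet.{u}}
    (h : codeWord (indexWord i) x = codeWord (indexWord j) y) : i = j ∧ x = y := by
  simp only [indexWord, codeWord, codeWord_replicate] at h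
  exact iterate_powerset_inj h

/-- The domain `V_α`. -/
abbrev Stage (α : Ordinal.{u}) : Type (u + 1) := {x : ZFSet.{u} // x ∈ ZFSet.vonNeumann α}

/-- The membership relation of `V_α`. -/
def stageMem (α : Ordinal.{u}) (x y : Stage α) : Prop := x.1 ∈ y.1

/-- `(V_α, ∈, A₀ ∩ V_α, …, Aₖ₋₁ ∩ V_α) ⊨ φ`. -/
def StageSatisfies (α : Ordinal.{u}) {k : ℕ} (A : Fin k → Set ZFSet.{u}) (φ : SOFormula 0 k) :
    Prop :=
  φ.Realize (stageMem α) Fin.elim0 fun j => {x | x.1 ∈ A j}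

theorem rankSatisfies_iff (α : Ordinal.{u}) (A : ZFSet.{u}) (φ : SOFormula 0 1) :
    RankSatisfies α A φ ↔ StageSatisfies α (fun _ => {x | x ∈ A}) φ := by
  have : (fun _ : Fin 1 => {x : Stage α | x.1 ∈ A ∩ ZFSet.vonNeumann α}) =
      fun _ => {x : Stage α | x.1 ∈ A} := by
    funext _
    ext x
    simp
  unfold RankSatisfies StageSatisfies
  rw [this]
  rfl

/-- `V_α` has no element of maximal rank. -/
def IsUnboundedStage (α : Ordinal.{u}) : Prop :=
  ∀ x : Stage α, ∃ y : Stage α, stageMem α x y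

theorem IsUnboundedStage.succ_rank_lt {α : Ordinal.{u}} (h : IsUnboundedStage α) {x : ZFSet.{u}}
    (hx : x ∈ ZFSet.vonNeumann α) : Order.succ x.rank < α := by
  obtain ⟨y, hy⟩ := h ⟨x, hx⟩
  exact (Order.succ_le_of_lt (ZFSet.rank_lt_of_mem hy)).trans_lt (ZFSet.mem_vonNeumann.1 y.2)

theorem IsUnboundedStage.singleton_mem {α : Ordinal.{u}} (h : IsUnboundedStage α) {x : ZFSet.{u}}
    (hx : x ∈ ZFSet.vonNeumann α) : {x} ∈ ZFSet.vonNeumann α := by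
  rw [ZFSet.mem_vonNeumann, ZFSet.rank_singleton]
  exact h.succ_rank_lt hx

theorem IsUnboundedStage.powerset_mem {α : Ordinal.{u}} (h : IsUnboundedStage α) {x : ZFSet.{u}}
    (hx : x ∈ ZFSet.vonNeumann α) : x.powerset ∈ ZFSet.vonNeumann α := by
  rw [ZFSet.mem_vonNeumann, ZFSet.rank_powerset]
  exact h.succ_rank_lt hx

theorem mem_vonNeumann_of_mem {α : Ordinal.{u}} {x y : ZFSet.{u}} (hxy : x ∈ y)
    (hy : y ∈ ZFSet.vonNeumann α) : x ∈ ZFSet.vonNeumann α :=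
  ZFSet.mem_vonNeumann.2 ((ZFSet.rank_lt_of_mem hxy).trans (ZFSet.mem_vonNeumann.1 hy))

theorem isOp_false_iff {α : Ordinal.{u}} (x y : Stage α) :
    IsOp (stageMem α) false x y ↔ y.1 = {x.1} := by
  constructor
  · intro h
    ext z
    rw [ZFSet.mem_singleton]
    exact ⟨fun hz => congrArg Subtype.val ((h ⟨z, mem_vonNeumann_of_mem hz y.2⟩).1 hz),
      fun hz => (h ⟨z, hz ▸ x.2⟩).2 (Subtype.ext hz)⟩
  · intro h z
    rw [stageMem, h, ZFSet.mem_singleton, Subtype.ext_iff]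

theorem isOp_true_iff {α : Ordinal.{u}} (x y : Stage α) (hx : x.1.powerset ∈ ZFSet.vonNeumann α) :
    IsOp (stageMem α) true x y ↔ y.1 = x.1.powerset := by
  have key : ∀ z : Stage α, (∀ w, stageMem α w z → stageMem α w x) ↔ z.1 ∈ x.1.powerset := by
    intro z
    rw [ZFSet.mem_powerset]
    exact ⟨fun h w hw => h ⟨w, mem_vonNeumann_of_mem hw z.2⟩ hw, fun h w hw => h hw⟩
  constructor
  · intro h
    ext z
    exact ⟨fun hz => (key ⟨z, mem_vonNeumann_of_mem hz y.2⟩).1 ((h _).1 hz),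
      fun hz => (h ⟨z, mem_vonNeumann_of_mem hz hx⟩).2 ((key _).2 hz)⟩
  · intro h z
    rw [key z, stageMem, h]

theorem decode_stage_iff {α : Ordinal.{u}} (hα : IsUnboundedStage α) (w : List Bool) (x : Stage α)
    (C : Set ZFSet.{u}) :
    Decode (stageMem α) w x {z | z.1 ∈ C} ↔
      codeWord w x.1 ∈ C ∧ codeWord w x.1 ∈ ZFSet.vonNeumann α := by
  induction w generalizing x with
  | nil => exact (and_iff_left x.2).symm
  | cons b w ih =>
    cases b with
    | false =>
      constructor
      · rintro ⟨y, hy, hd⟩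
        rw [isOp_false_iff] at hy
        rw [ih, hy] at hd
        exact hd
      · intro h
        exact ⟨⟨_, hα.singleton_mem x.2⟩, (isOp_false_iff _ _).2 rfl, (ih _).2 h⟩
    | true =>
      have hp := hα.powerset_mem x.2
      constructor
      · rintro ⟨y, hy, hd⟩
        rw [isOp_true_iff _ _ hp] at hy
        rw [ih, hy] at hd
        exact hd
      · intro h
        exact ⟨⟨_, hp⟩, (isOp_true_iff _ _ hp).2 rfl, (ih _).2 h⟩

theorem codeWord_mem {α : Ordinal.{u}} (hα : IsUnboundedStage α) (w : List Bool) {x : ZFSet.{u}}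
    (hx : x ∈ ZFSet.vonNeumann α) : codeWord w x ∈ ZFSet.vonNeumann α := by
  induction w generalizing x with
  | nil => exact hx
  | cons b w ih =>
    cases b with
    | false => exact ih (hα.singleton_mem hx)
    | true => exact ih (hα.powerset_mem hx)

theorem IsRegularOrdinal.isUnboundedStage {κ : Ordinal.{u}} (h : IsRegularOrdinal κ) :
    IsUnboundedStage κ := by
  obtain ⟨c, hc, rfl⟩ := h
  intro x
  refine ⟨⟨{x.1}, ?_⟩, ZFSet.mem_singleton.2 rfl⟩
  rw [ZFSet.mem_vonNeumann, ZFSet.rank_singleton]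
  exact (Cardinal.isSuccLimit_ord hc.aleph0_le).succ_lt (ZFSet.mem_vonNeumann.1 x.2)

/-- The disjoint union of the `A j`, in coded form. -/
def codeSet {k : ℕ} (A : Fin k → Set ZFSet.{u}) : Set ZFSet.{u} :=
  {z | ∃ j, ∃ x ∈ A j, z = codeWord (indexWord j) x}

theorem codeWord_mem_codeSet {k : ℕ} (A : Fin k → Set ZFSet.{u}) (j : Fin k) (x : ZFSet.{u}) :
    codeWord (indexWord j) x ∈ codeSet A ↔ x ∈ A j := by
  constructor
  · rintro ⟨i, y, hy, h⟩
    obtain ⟨hij, rfl⟩ := codeWord_indexWord_inj h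
    rwa [Fin.ext hij]
  · exact fun h => ⟨j, x, h, rfl⟩

theorem stageSatisfies_translate {α κ : Ordinal.{u}} (hακ : α ≤ κ) (hα : IsUnboundedStage α) {k : ℕ}
    (A : Fin k → Set ZFSet.{u}) (φ : SOFormula 0 k) :
    StageSatisfies α (fun _ : Fin 1 => {x | x ∈ (ZFSet.vonNeumann κ).sep (codeSet A)})
      (φ.translate fun j => (indexWord j, 0)) ↔ StageSatisfies α A φ := by
  refine realize_translate φ _ _ _ _ fun j x => ?_
  have hc := codeWord_mem hα (indexWord j) x.2
  have hc' : codeWord (indexWord j) x.1 ∈ ZFSet.vonNeumann κ :=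
    ZFSet.mem_vonNeumann.2 ((ZFSet.mem_vonNeumann.1 hc).trans_le hακ)
  rw [decode_stage_iff hα, and_iff_left hc]
  exact ZFSet.mem_sep.trans ((and_iff_right hc').trans (codeWord_mem_codeSet A j x.1))

/-- Indescribable sets reflect `Π¹ₙ` formulas with any finite number of predicates. -/
theorem IsIndescribable.exists_stageSatisfies {n : ℕ} {κ : Ordinal.{u}} {S : Set Ordinal.{u}}
    (hS : IsIndescribable n κ S) {k : ℕ} (A : Fin k → Set ZFSet.{u}) {φ : SOFormula 0 k}
    (hφ : φ.IsPi n) (h : StageSatisfies κ A φ) : ∃ α ∈ S, StageSatisfies α A φ := by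
  obtain ⟨χ, hχ, e⟩ := IsPi.exists_and.{u + 1} (hφ.translate fun j => (indexWord j, (0 : Fin 1)))
    ((isFirstOrder_limit 1).isPi n)
  have hκ := hS.1.isUnboundedStage
  obtain ⟨α, hα, hs⟩ := hS.2.2 ((ZFSet.vonNeumann κ).sep (codeSet A))
    (fun z hz => (ZFSet.mem_sep.1 hz).1) χ hχ <| (rankSatisfies_iff _ _ _).2 <| (e _ _ _ _).2
      ⟨(stageSatisfies_translate le_rfl hκ A φ).2 h, (realize_limit _ _).2 hκ⟩
  obtain ⟨h₁, h₂⟩ := (e _ _ _ _).1 ((rankSatisfies_iff _ _ _).1 hs)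
  exact ⟨α, hα, (stageSatisfies_translate (hS.2.1 hα).le ((realize_limit _ _).1 h₂) A φ).1 h₁⟩

theorem stageSatisfies_cons {α : Ordinal.{u}} {k : ℕ} (B : Set ZFSet.{u})
    (A : Fin k → Set ZFSet.{u}) (φ : SOFormula 0 (k + 1)) :
    StageSatisfies α (Fin.cons B A) φ ↔ φ.Realize (stageMem α) Fin.elim0
      (Fin.cons {x : Stage α | x.1 ∈ B} fun j => {x : Stage α | x.1 ∈ A j}) := by
  have : (fun j => {x : Stage α | x.1 ∈ (Fin.cons B A : Fin (k + 1) → Set ZFSet.{u}) j}) =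
      Fin.cons {x : Stage α | x.1 ∈ B} fun j => {x : Stage α | x.1 ∈ A j} := by
    funext j
    refine Fin.cases ?_ (fun j => ?_) j <;> simp
  rw [StageSatisfies, this]

/-- Indescribable sets reflect `Σ¹ₙ₊₁` formulas: the witnesses for the first block of quantifiers
serve as additional predicates. -/
theorem IsIndescribable.exists_stageSatisfies_of_isSigma_succ {n : ℕ} {κ : Ordinal.{u}}
    {S : Set Ordinal.{u}} (hS : IsIndescribable n κ S) : {k : ℕ} → (A : Fin k → Set ZFSet.{u}) →
    {φ : SOFormula 0 k} → φ.IsSigma (n + 1) → StageSatisfies κ A φ →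
      ∃ α ∈ S, StageSatisfies α A φ
  | _, A, _, .ofPi hφ, h => hS.exists_stageSatisfies A hφ h
  | _, A, _, .exSet (φ := φ) hφ, h => by
    obtain ⟨Y, hY⟩ := h
    have hY' : {x : Stage κ | x.1 ∈ Subtype.val '' Y} = Y := by
      ext x
      simp
    obtain ⟨α, hα, hs⟩ := exists_stageSatisfies_of_isSigma_succ hS
      (Fin.cons (Subtype.val '' Y) A) hφ ((stageSatisfies_cons _ _ _).2 (by rwa [hY']))
    exact ⟨α, hα, _, (stageSatisfies_cons _ _ _).1 hs⟩

theorem IsIndescribable.mono {n : ℕ} {κ : Ordinal.{u}} {S T : Set Ordinal.{u}}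
    (hS : IsIndescribable n κ S) (hST : S ⊆ T) (hT : T ⊆ Set.Iio κ) : IsIndescribable n κ T :=
  ⟨hS.1, hT, fun A hA φ hφ h =>
    let ⟨α, hα, hs⟩ := hS.2.2 A hA φ hφ h
    ⟨α, hST hα, hs⟩⟩

/-- An indescribable set stays indescribable when it is restricted to the stages that satisfy a
given true `Π¹ₙ` sentence. -/
theorem IsIndescribable.sep {n : ℕ} {κ : Ordinal.{u}} {S : Set Ordinal.{u}}
    (hS : IsIndescribable n κ S) (A : ZFSet.{u}) {φ : SOFormula 0 1} (hφ : φ.IsPi n)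
    (h : RankSatisfies κ A φ) : IsIndescribable n κ {α ∈ S | RankSatisfies α A φ} := by
  refine ⟨hS.1, fun α hα => hS.2.1 hα.1, fun B _ ψ hψ hB => ?_⟩
  have hr : ∀ (j : Fin 2) (D : ZFSet.{u}) (θ : SOFormula 0 1) (α : Ordinal.{u}),
      (![A, B] j = D) → (StageSatisfies α (fun i => {x | x ∈ ![A, B] i})
        (θ.translate fun _ => ([], j)) ↔ RankSatisfies α D θ) := by
    rintro j D θ α rfl
    rw [rankSatisfies_iff]
    exact realize_translate θ _ _ _ _ fun _ x => Iff.rfl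
  obtain ⟨χ, hχ, e⟩ := IsPi.exists_and.{u + 1} (hφ.translate fun _ => ([], (0 : Fin 2)))
    (hψ.translate fun _ => ([], (1 : Fin 2)))
  obtain ⟨α, hα, hs⟩ := hS.exists_stageSatisfies (fun i => {x | x ∈ ![A, B] i}) hχ <|
    (e _ _ _ _).2 ⟨(hr 0 A φ κ rfl).2 h, (hr 1 B ψ κ rfl).2 hB⟩
  obtain ⟨h₁, h₂⟩ := (e _ _ _ _).1 hs
  exact ⟨α, ⟨hα, (hr 0 A φ α rfl).1 h₁⟩, (hr 1 B ψ α rfl).1 h₂⟩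

/-- A `Π¹ₙ` sentence that holds at all points of an indescribable set holds at the top. -/
theorem IsIndescribable.rankSatisfies_of_forall {n : ℕ} {κ : Ordinal.{u}} {S : Set Ordinal.{u}}
    (hS : IsIndescribable n κ S) (A : ZFSet.{u}) {φ : SOFormula 0 1} (hφ : φ.IsPi n)
    (h : ∀ α ∈ S, RankSatisfies α A φ) : RankSatisfies κ A φ := by
  by_contra hκ
  obtain ⟨ψ, hψ, e⟩ := IsPi.exists_neg.{u + 1} hφ
  rw [rankSatisfies_iff] at hκ
  obtain ⟨α, hα, hs⟩ := hS.exists_stageSatisfies_of_isSigma_succ _ hψ.succ ((e _ _ _ _).2 hκ)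
  exact (e _ _ _ _).1 hs ((rankSatisfies_iff _ _ _).1 (h α hα))

theorem lemma3p1 (n : ℕ) (κ : Ordinal.{u}) (hκ : Refl n κ) (S : Set Ordinal.{u})
    (hS : IsIndescribable n κ S) : IsIndescribable n κ (Tr n κ S) := by
  refine ⟨hS.1, fun α hα => hα.1, fun A _ φ hφ h => ?_⟩
  obtain ⟨γ, hγ, hT⟩ := hκ.2 _ (hS.sep A hφ h)
  exact ⟨γ, ⟨hγ, hT.mono (fun α hα => ⟨hα.1.1, hα.2⟩) Set.inter_subset_right⟩,
    hT.rankSatisfies_of_forall A hφ fun α hα => hα.1.2⟩
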